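/- Let $\mathbb X,\mathbb Y$ be real or complex Hilbert spaces, $\Omega\subseteq\mathbb X$ open, $F:\Omega\to\mathbb Y$ continuously (Fréchet) differentiable such that $F'(x)$ has closed image for every $x\in\Omega$, and $J:\Omega\to\mathbb R\cup\{+\infty\}$ proper, convex and lower semicontinuous, extended by $+\infty$ outside $\Omega$. (More generally $J:\mathbb X\to\mathbb R\cup\{+\infty\}$ may be any function that is finite somewhere in $\Omega$, is lower semicontinuous at the points of $\Omega$, and satisfies $J(ax+by)\le aJ(x)+bJ(y)$ whenever $x,y\in\mathbb X$, $a,b>0$, $a+b=1$ and $ax+by\in\Omega$.) For $A\in\mathcal L(\mathbb X,\mathbb Y)$ with closed image, $A^\dagger$ denotes its Moore–Penrose inverse. Put $H(x)=F'(x)^*F'(x)$, and for a positive invertible $H$ let $$\mathrm{prox}_J^{H}(z)=\operatorname*{argmin}_{x\in\mathbb X}\Big\{J(x)+\tfrac12\langle x-z,H(x-z)\rangle\Big\}.$$ The subdifferential is $\partial J(x)=\{u: J(y)\ge J(x)+\mathrm{Re}\,\langle u,y-x\rangle\ \text{for all } y\in\mathbb X\}$ if $J(x)<+\infty$, and is empty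 otherwise. Let $x_*\in\Omega$, $R>0$, and $$\beta=\|F'(x_*)^\dagger\|,\qquad \kappa=\beta\|F'(x_*)\|,\qquad \delta=\sup\{t\in[0,R): B(x_*,t)\subset\Omega\},\qquad \sigma(x)=\|x-x_*\|.$$ Suppose that $F(x_*)=0$, $0\in\partial J(x_*)$, $F'(x_*)$ is injective, and there is a continuously differentiable $f:[0,R)\to\mathbb R$ with $$\beta\,\|F'(x)-F'(x_*+\tau(x-x_*))\|\le f'(\sigma(x))-f'(\tau\sigma(x))\qquad\text{for all }x\in B(x_*,\delta),\ \tau\in[0,1],$$ such that * (h1) $f(0)=0$ and $f'(0)=-1$; * (h2) $f'$ is convex and strictly increasing on $[0,R)$. Put $$\nu=\sup\{t\in[0,R): f'(t)<0\},\qquad \rho=\sup\Big\{t\in(0,\nu):\frac{[f'(t)+1+\kappa]\,[tf'(t)-f(t)]}{t[f'(t)]^2}<1\Big\},\qquad r=\min\{\rho,\delta\}.$$ Then $\delta,\nu,\rho,r$ are positive, and for every $x_0\in B(x_*,r)\setminus\{x_*\}$ the proximal Gauss–Newton method $$x_{k+1}=\mathrm{prox}_J^{H(x_k)}\big(x_k-F'(x_k)^\dagger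 F(x_k)\big),\qquad k=0,1,\dots,$$ is well defined (for every $k$: $x_k\in\Omega$, $F'(x_k)$ is injective and has a unique Moore–Penrose inverse, $H(x_k)$ is invertible, and the minimizer defining $x_{k+1}$ exists and is unique), the sequence $\{x_k\}$ is contained in $B(x_*,r)$ and converges to $x_*$, and $$\|x_{k+1}-x_*\|\le\frac{[f'(\sigma(x_0))+1+\kappa]\,[f'(\sigma(x_0))\sigma(x_0)-f(\sigma(x_0))]}{[\sigma(x_0)f'(\sigma(x_0))]^2}\,\|x_k-x_*\|^2,\qquad k=0,1,\dots.$$ -/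

import Mathlib

namespace ProxGN

noncomputable section

section

variable {𝕜 : Type*} [RCLike 𝕜]
  {X : Type*} [NormedAddCommGroup X] [InnerProductSpace 𝕜 X]
  {Y : Type*} [NormedAddCommGroup Y] [InnerProductSpace 𝕜 Y]

/-- The four Penrose equations: `B` is a Moore-Penrose inverse of `A`. -/
structure IsMoorePenrose [CompleteSpace X] [CompleteSpace Y]
    (A : X →L[𝕜] Y) (B : Y →L[𝕜] X) : Prop where
  mul_mul_left : A ∘L B ∘L A = A
  mul_mul_right : B ∘L A ∘L B = B
  selfAdjoint_left : IsSelfAdjoint (A ∘L B)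
  selfAdjoint_right : IsSelfAdjoint (B ∘L A)

/-- The Moore-Penrose inverse of a bounded operator. It exists, and is unique, exactly when
the image of `A` is closed; otherwise the value is arbitrary. -/
def pinv [CompleteSpace X] [CompleteSpace Y] (A : X →L[𝕜] Y) : Y →L[𝕜] X :=
  Classical.epsilon (IsMoorePenrose A)

/-- `J` is a proper, convex and lower semicontinuous functional on `Ω` with values in
`ℝ ∪ {+∞}`.

A functional given only on `Ω` is regarded as a function on the whole space that is `+∞` outside
`Ω`; then the clause `convex` is Jensen's inequality for all points `x`, `y` and `a x + b y` of `Ω`.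
A functional that is proper (with a finite value in `Ω`), convex and lower semicontinuous on the
whole space is covered as well. -/
structure IsProperConvexLscOn (𝕜 : Type*) [RCLike 𝕜] {X : Type*} [NormedAddCommGroup X]
    [InnerProductSpace 𝕜 X] (Ω : Set X) (J : X → EReal) : Prop where
  ne_bot : ∀ x, J x ≠ ⊥
  exists_ne_top : ∃ x ∈ Ω, J x ≠ ⊤
  convex : ∀ (x y : X) (a b : ℝ), 0 < a → 0 < b → a + b = 1 →
    (a : 𝕜) • x + (b : 𝕜) • y ∈ Ω →
    J ((a : 𝕜) • x + (b : 𝕜) • y) ≤ (a : EReal) * J x + (b : EReal) * J y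
  lsc : LowerSemicontinuousOn J Ω

/-- The subdifferential `∂J(x)` of convex analysis (it is empty where `J x = +∞`). In a complex
space the duality is through the real part of the inner product. -/
def subdifferential (𝕜 : Type*) [RCLike 𝕜] {X : Type*} [NormedAddCommGroup X]
    [InnerProductSpace 𝕜 X] (J : X → EReal) (x : X) : Set X :=
  {u | J x ≠ ⊤ ∧ ∀ y, J x + ((RCLike.re (inner 𝕜 u (y - x)) : ℝ) : EReal) ≤ J y}

/-- The objective `x ↦ J(x) + (1/2) ‖x - z‖_H²` of the proximity operator, where
`‖v‖_H² = ⟨v, H v⟩`. -/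
def proxObjective (J : X → EReal) (H : X →L[𝕜] X) (z x : X) : EReal :=
  J x + ((1 / 2 * RCLike.re (inner 𝕜 (x - z) (H (x - z))) : ℝ) : EReal)

/-- `p` is a minimizer over the whole space of the objective of the proximity operator at `z`. -/
def IsProxPoint (J : X → EReal) (H : X →L[𝕜] X) (z p : X) : Prop :=
  ∀ y, proxObjective J H z p ≤ proxObjective J H z y

/-- The proximity operator of `J` in the metric of `H`: the minimizer of the objective
(arbitrary if there is none). -/
def prox (J : X → EReal) (H : X →L[𝕜] X) (z : X) : X :=
  Classical.epsilon (IsProxPoint J H z)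

variable [CompleteSpace X] [CompleteSpace Y]

variable (𝕜) in
/-- `H(x) = F'(x)* F'(x)`. -/
def metricOp (F : X → Y) (x : X) : X →L[𝕜] X :=
  ContinuousLinearMap.adjoint (fderiv 𝕜 F x) ∘L fderiv 𝕜 F x

variable (𝕜) in
/-- The Gauss-Newton point `x - F'(x)† F(x)`. -/
def gaussNewtonPoint (F : X → Y) (x : X) : X :=
  x - pinv (fderiv 𝕜 F x) (F x)

variable (𝕜) in
/-- The proximal Gauss-Newton iterates started at `x₀`. -/
def iterate (F : X → Y) (J : X → EReal) (x₀ : X) : ℕ → X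
  | 0 => x₀
  | k + 1 => prox J (metricOp 𝕜 F (iterate F J x₀ k)) (gaussNewtonPoint 𝕜 F (iterate F J x₀ k))

variable (𝕜) in
/-- The step of the method from `x` is well defined: `x` lies in the domain of `F`, `F'(x)` is
injective and has a unique Moore-Penrose inverse, `H(x)` is invertible, and the objective of the
proximity operator has exactly one minimizer. -/
structure StepWellDefined (Ω : Set X) (F : X → Y) (J : X → EReal) (x : X) : Prop where
  mem : x ∈ Ω
  injective : Function.Injective (fderiv 𝕜 F x)
  pinv_exists : ∃! B : Y →L[𝕜] X, IsMoorePenrose (fderiv 𝕜 F x) B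
  isUnit : IsUnit (metricOp 𝕜 F x)
  prox_exists : ∃! p : X, IsProxPoint J (metricOp 𝕜 F x) (gaussNewtonPoint 𝕜 F x) p

end

end

end ProxGN

/-! Write `A = F'(x)`, `s = ‖x - xs‖`, `z` for the Gauss–Newton point and `p` for the next iterate.
The majorant condition with `τ = 0` perturbs injectivity of `F'(xs)` into `‖A v‖ ≥ (-f' s / β) ‖v‖`,
and integrating it along the segment bounds `β ‖A (x - xs) - F x‖` by `e = s f' s - f s`
(`norm_linearization_le`). Since `z - xs = A† (A (x - xs) - F x)` and `A A†` is an orthogonal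
projection, `β ‖A (z - xs)‖ ≤ e`.

As `0 ∈ ∂J(xs)`, `xs` minimizes `J`, and strong convexity of the prox objective in the norm `‖A ·‖`
gives `‖A (p - xs)‖ ≤ ‖A (z - xs)‖` (`existsUnique_isProxPoint`). Hence `‖p - xs‖ ≤ e / (-f' s)`,
which is at most `C s * s ^ 2` for the stated rate `C`. Convexity of `f'` makes `C` nondecreasing
(`rate_mono`), so `C s * s < 1` below `ρ` and the errors decay geometrically.

`J` is controlled only on `Ω`, so the minimizer is first found on an ellipsoid inside `Ω`; being
interior, it is then global by convexity. -/

namespace ProxGN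

/-! ### Moore–Penrose inverses of operators bounded below -/

section MoorePenrose

variable {𝕜 : Type*} [RCLike 𝕜]
  {X : Type*} [NormedAddCommGroup X] [InnerProductSpace 𝕜 X] [CompleteSpace X]
  {Y : Type*} [NormedAddCommGroup Y] [InnerProductSpace 𝕜 Y] [CompleteSpace Y]

open ContinuousLinearMap in
/-- The normal operator of a bounded-below operator is invertible. -/
theorem isUnit_adjoint_comp_self {A : X →L[𝕜] Y} {c : ℝ} (hc : 0 < c)
    (hA : ∀ v, c * ‖v‖ ≤ ‖A v‖) : IsUnit (adjoint A ∘L A) := by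
  refine isUnit_of_forall_le_norm_inner_map _ (c := ⟨c ^ 2, by positivity⟩)
    (show (0 : ℝ) < c ^ 2 by positivity) fun v ↦ ?_
  rw [comp_apply, adjoint_inner_left, inner_self_eq_norm_sq_to_K]
  simp only [norm_pow, RCLike.norm_ofReal, abs_norm]
  have := pow_le_pow_left₀ (by positivity) (hA v) 2
  change ‖v‖ ^ 2 * c ^ 2 ≤ _
  nlinarith

/-- `A B` and `A C` are self-adjoint projections onto the same range: adjoints reverse `A B = (A
C)(A B)`, so they agree. Likewise `B A = C A`, and `B = B A B = C A C = C`. -/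
theorem IsMoorePenrose.eq {A : X →L[𝕜] Y} {B C : Y →L[𝕜] X} (hB : IsMoorePenrose A B)
    (hC : IsMoorePenrose A C) : B = C := by
  have e1 : A ∘L B = A ∘L C := by
    have h : A ∘L B = (A ∘L C) * (A ∘L B) := by
      conv_lhs => rw [← hC.mul_mul_left]
      rfl
    have h' := congrArg star h
    rw [star_mul, hB.selfAdjoint_left.star_eq, hC.selfAdjoint_left.star_eq] at h'
    rw [h']
    change (A ∘L B ∘L A) ∘L C = _
    rw [hB.mul_mul_left]
  have e2 : B ∘L A = C ∘L A := by
    have h : B ∘L A = (B ∘L A) * (C ∘L A) := by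
      conv_lhs => rw [← hC.mul_mul_left]
      rfl
    have h' := congrArg star h
    rw [star_mul, hB.selfAdjoint_right.star_eq, hC.selfAdjoint_right.star_eq] at h'
    rw [h']
    change C ∘L (A ∘L B ∘L A) = _
    rw [hB.mul_mul_left]
  calc B = B ∘L (A ∘L B) := hB.mul_mul_right.symm
    _ = (B ∘L A) ∘L C := by rw [e1]; rfl
    _ = C ∘L A ∘L C := by rw [e2]; rfl
    _ = C := hC.mul_mul_right

-- The inverse is `(A* A)⁻¹ A*`, a left inverse of `A`; only self-adjointness of `A B` needs that of
-- `(A* A)⁻¹`.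
open ContinuousLinearMap in
theorem existsUnique_isMoorePenrose {A : X →L[𝕜] Y} {c : ℝ} (hc : 0 < c)
    (hA : ∀ v, c * ‖v‖ ≤ ‖A v‖) : ∃! B : Y →L[𝕜] X, IsMoorePenrose A B := by
  obtain ⟨u, hu⟩ := isUnit_adjoint_comp_self hc hA
  set G : X →L[𝕜] X := (↑u⁻¹ : X →L[𝕜] X) with hG
  have hsu : star (u : X →L[𝕜] X) = u := by
    rw [hu, star_eq_adjoint, adjoint_comp, adjoint_adjoint]
  have hsG : adjoint G = G := by
    have h1 : star G * u = 1 := by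
      rw [← hsu, ← star_mul, hG, Units.mul_inv, star_one]
    have := Units.eq_inv_of_mul_eq_one_right h1
    exact (star_eq_adjoint G).symm.trans (by simpa [hG] using this)
  have hGA : (G ∘L adjoint A) ∘L A = 1 := by
    change G * (adjoint A ∘L A) = 1
    rw [← hu, hG, Units.inv_mul]
  refine ⟨G ∘L adjoint A, ⟨?_, ?_, ?_, ?_⟩, fun C hC ↦ hC.eq ⟨?_, ?_, ?_, ?_⟩⟩
  all_goals first
    | (rw [hGA]; rfl)
    | (rw [hGA]; exact IsSelfAdjoint.one _)
    | (rw [← comp_assoc, hGA]; rfl)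
    | (rw [isSelfAdjoint_iff', adjoint_comp, adjoint_comp, adjoint_adjoint, hsG]; rfl)

theorem isMoorePenrose_pinv {A : X →L[𝕜] Y} {c : ℝ} (hc : 0 < c)
    (hA : ∀ v, c * ‖v‖ ≤ ‖A v‖) : IsMoorePenrose A (pinv A) :=
  Classical.epsilon_spec (existsUnique_isMoorePenrose hc hA).exists

theorem IsMoorePenrose.apply_apply {A : X →L[𝕜] Y} {B : Y →L[𝕜] X} (h : IsMoorePenrose A B)
    (hA : Function.Injective A) (v : X) : B (A v) = v :=
  hA (DFunLike.congr_fun h.mul_mul_left v)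

/-- `A ∘ A†` is an orthogonal projection, hence a contraction. -/
theorem IsMoorePenrose.norm_apply_le {A : X →L[𝕜] Y} {B : Y →L[𝕜] X} (h : IsMoorePenrose A B)
    (y : Y) : ‖A (B y)‖ ≤ ‖y‖ := by
  have h1 : inner 𝕜 (A (B y)) (A (B y)) = inner 𝕜 y (A (B y)) := by
    have h2 := ContinuousLinearMap.adjoint_inner_left (A ∘L B) (A (B y)) y
    rw [← ContinuousLinearMap.star_eq_adjoint, h.selfAdjoint_left.star_eq] at h2
    have h3 : A (B (A (B y))) = A (B y) := DFunLike.congr_fun h.mul_mul_left (B y)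
    have h4 := ContinuousLinearMap.adjoint_inner_left (A ∘L B) (A (B y)) y
    rw [← ContinuousLinearMap.star_eq_adjoint, h.selfAdjoint_left.star_eq] at h4
    have h5 := ContinuousLinearMap.adjoint_inner_right (A ∘L B) y (A (B y))
    rw [← ContinuousLinearMap.star_eq_adjoint, h.selfAdjoint_left.star_eq] at h5
    simp only [ContinuousLinearMap.comp_apply, h3] at h5
    exact h5.symm
  have h6 : ‖A (B y)‖ ^ 2 ≤ ‖y‖ * ‖A (B y)‖ := by
    rw [← inner_self_eq_norm_sq (𝕜 := 𝕜), h1]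
    exact (RCLike.re_le_norm _).trans (norm_inner_le_norm _ _)
  by_contra! hlt
  nlinarith [norm_nonneg y]

theorem exists_pos_mul_norm_le {A : X →L[𝕜] Y} (hA : Function.Injective A)
    (hcl : IsClosed (Set.range A)) : ∃ c, 0 < c ∧ ∀ v, c * ‖v‖ ≤ ‖A v‖ := by
  obtain ⟨K, hK⟩ := A.antilipschitz_of_injective_of_isClosed_range hA hcl
  -- The `+ 1` guards against `K = 0`.
  refine ⟨((K : ℝ) + 1)⁻¹, by positivity, fun v ↦ ?_⟩
  have := A.bound_of_antilipschitz hK v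
  rw [inv_mul_le_iff₀ (by positivity)]
  nlinarith [norm_nonneg (A v)]

end MoorePenrose

/-! ### The scalar majorant -/

section Majorant

variable {f f' : ℝ → ℝ} {R : ℝ}

theorem mul_mem_Ico {t u : ℝ} (ht : t ∈ Set.Ico 0 R) (hu : u ∈ Set.Icc (0 : ℝ) 1) :
    u * t ∈ Set.Ico 0 R :=
  ⟨mul_nonneg hu.1 ht.1, (mul_le_of_le_one_left ht.1 hu.2).trans_lt ht.2⟩

/-- Derivative of the linearization error of `f` along `[0, t]`. -/
theorem hasDerivWithinAt_linearization
    (hf : ∀ t ∈ Set.Ico 0 R, HasDerivWithinAt f (f' t) (Set.Ico 0 R) t)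
    {t u : ℝ} (ht : t ∈ Set.Ico 0 R) (hu : u ∈ Set.Icc (0 : ℝ) 1) :
    HasDerivWithinAt (fun u ↦ u * (t * f' t) - f (u * t)) (t * (f' t - f' (u * t)))
      (Set.Icc 0 1) u := by
  have h1 : HasDerivWithinAt (fun u : ℝ ↦ u * t) (1 * t) (Set.Icc 0 1) u :=
    (hasDerivWithinAt_id u _).mul_const t
  have h2 := (hf _ (mul_mem_Ico ht hu)).comp u h1 fun v hv ↦ mul_mem_Ico ht hv
  have h3 := ((hasDerivWithinAt_id u (Set.Icc (0 : ℝ) 1)).mul_const (t * f' t)).sub h2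
  exact h3.congr_deriv (by ring)

theorem linearization_nonneg
    (hf : ∀ t ∈ Set.Ico 0 R, HasDerivWithinAt f (f' t) (Set.Ico 0 R) t) (h0 : f 0 = 0)
    (hmono : MonotoneOn f' (Set.Ico 0 R)) {t : ℝ} (ht : t ∈ Set.Ico 0 R) :
    0 ≤ t * f' t - f t := by
  have hd := fun u (hu : u ∈ Set.Icc (0 : ℝ) 1) ↦ hasDerivWithinAt_linearization hf ht hu
  have := monotoneOn_of_hasDerivWithinAt_nonneg (convex_Icc 0 1)
    (fun u hu ↦ (hd u hu).continuousWithinAt)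
    (fun u hu ↦ (hd u (interior_subset hu)).mono interior_subset)
    (fun u hu ↦ mul_nonneg ht.1 (sub_nonneg.2 (hmono (mul_mem_Ico ht (interior_subset hu)) ht
      (mul_le_of_le_one_left ht.1 (interior_subset hu).2))))
    (Set.left_mem_Icc.2 zero_le_one) (Set.right_mem_Icc.2 zero_le_one) zero_le_one
  simpa [h0] using this

theorem linearization_le
    (hf : ∀ t ∈ Set.Ico 0 R, HasDerivWithinAt f (f' t) (Set.Ico 0 R) t) (h0 : f 0 = 0)
    (hmono : MonotoneOn f' (Set.Ico 0 R)) {t : ℝ} (ht : t ∈ Set.Ico 0 R) :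
    t * f' t - f t ≤ t * (f' t - f' 0) := by
  have hd := fun u (hu : u ∈ Set.Icc (0 : ℝ) 1) ↦
    ((hasDerivWithinAt_id u (Set.Icc (0 : ℝ) 1)).mul_const (t * (f' t - f' 0))).sub
      (hasDerivWithinAt_linearization hf ht hu)
  have := monotoneOn_of_hasDerivWithinAt_nonneg (convex_Icc 0 1)
    (fun u hu ↦ (hd u hu).continuousWithinAt)
    (fun u hu ↦ (hd u (interior_subset hu)).mono interior_subset)
    (fun u hu ↦ by
      have h := mul_mem_Ico ht (interior_subset hu)
      have := hmono ⟨le_rfl, h.1.trans_lt h.2⟩ h h.1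
      nlinarith [ht.1])
    (Set.left_mem_Icc.2 zero_le_one) (Set.right_mem_Icc.2 zero_le_one) zero_le_one
  simp [h0] at this
  linarith

/-- Slopes of a convex function increase: the chord of `f'` over `[u s, s]` is compared with the one
over `[u t, t]` through `[u s, t]`. The lengths are `(1 - u) s` and `(1 - u) t`, so `1 - u` cancels.
-/
theorem ConvexOn.mul_increment_le (hconv : ConvexOn ℝ (Set.Ico 0 R) f') {s t u : ℝ}
    (hs : 0 < s) (hst : s ≤ t) (ht : t < R) (hu : u ∈ Set.Icc (0 : ℝ) 1) :
    t * (f' s - f' (u * s)) ≤ s * (f' t - f' (u * t)) := by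
  obtain ⟨hu0, hu1⟩ := hu
  rcases hu1.eq_or_lt with rfl | hu1
  · simp
  have ht0 : 0 < t := hs.trans_le hst
  have hsm : s ∈ Set.Ico 0 R := ⟨hs.le, hst.trans_lt ht⟩
  have htm : t ∈ Set.Ico 0 R := ⟨ht0.le, ht⟩
  have hus := mul_mem_Ico hsm ⟨hu0, hu1.le⟩
  have hut := mul_mem_Ico htm ⟨hu0, hu1.le⟩
  have l1 : u * s < s := by nlinarith
  have l2 : u * t < t := by nlinarith
  have l3 : u * s ≤ u * t := by gcongr
  have a1 := hconv.secant_mono hus hsm htm l1.ne' (l1.trans_le hst).ne' hst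
  have a2 := hconv.secant_mono htm hus hut (l1.trans_le hst).ne l2.ne l3
  have e : (f' t - f' (u * s)) / (t - u * s) = (f' (u * s) - f' t) / (u * s - t) := by
    rw [← neg_sub t, ← neg_sub (f' t), neg_div_neg_eq]
  rw [e] at a1
  have a3 := a1.trans a2
  rw [← neg_sub t, ← neg_sub (f' t), neg_div_neg_eq, div_le_div_iff₀ (by linarith) (by linarith)]
    at a3
  have : 0 < 1 - u := by linarith
  nlinarith

/-- `(t f'(t) - f(t)) / t²` is nondecreasing if `f'` is convex. -/
theorem linearization_mul_sq_le
    (hf : ∀ t ∈ Set.Ico 0 R, HasDerivWithinAt f (f' t) (Set.Ico 0 R) t) (h0 : f 0 = 0)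
    (hconv : ConvexOn ℝ (Set.Ico 0 R) f') {s t : ℝ} (hs : 0 < s) (hst : s ≤ t) (ht : t < R) :
    (s * f' s - f s) * t ^ 2 ≤ (t * f' t - f t) * s ^ 2 := by
  have hsm : s ∈ Set.Ico 0 R := ⟨hs.le, hst.trans_lt ht⟩
  have htm : t ∈ Set.Ico 0 R := ⟨hs.le.trans hst, ht⟩
  have hd := fun u (hu : u ∈ Set.Icc (0 : ℝ) 1) ↦
    ((hasDerivWithinAt_linearization hf htm hu).mul_const (s ^ 2)).sub
      ((hasDerivWithinAt_linearization hf hsm hu).mul_const (t ^ 2))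
  have := monotoneOn_of_hasDerivWithinAt_nonneg (convex_Icc 0 1)
    (fun u hu ↦ (hd u hu).continuousWithinAt)
    (fun u hu ↦ (hd u (interior_subset hu)).mono interior_subset)
    (fun u hu ↦ by
      have h := ConvexOn.mul_increment_le hconv hs hst ht (interior_subset hu)
      have h' := mul_le_mul_of_nonneg_left h (mul_nonneg hs.le htm.1)
      nlinarith)
    (Set.left_mem_Icc.2 zero_le_one) (Set.right_mem_Icc.2 zero_le_one) zero_le_one
  simp [h0] at this
  linarith

/-- The factor of the quadratic convergence estimate is nondecreasing where `f'` is negative. -/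
theorem rate_mono
    (hf : ∀ t ∈ Set.Ico 0 R, HasDerivWithinAt f (f' t) (Set.Ico 0 R) t)
    (h0 : f 0 = 0) (h0' : f' 0 = -1)
    (hconv : ConvexOn ℝ (Set.Ico 0 R) f') (hmono : MonotoneOn f' (Set.Ico 0 R))
    {κ : ℝ} (hκ : 0 ≤ κ) {s t : ℝ} (hs : 0 < s) (hst : s ≤ t) (ht : t < R) (hft : f' t < 0) :
    (f' s + 1 + κ) * (f' s * s - f s) / (s * f' s) ^ 2 ≤
      (f' t + 1 + κ) * (f' t * t - f t) / (t * f' t) ^ 2 := by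
  have ht0 : 0 < t := hs.trans_le hst
  have hsm : s ∈ Set.Ico 0 R := ⟨hs.le, hst.trans_lt ht⟩
  have htm : t ∈ Set.Ico 0 R := ⟨ht0.le, ht⟩
  have h0m : (0 : ℝ) ∈ Set.Ico 0 R := ⟨le_rfl, ht0.trans ht⟩
  have i1 := hmono h0m hsm hs.le
  have i2 := hmono hsm htm hst
  have i3 : (s * f' s - f s) / s ^ 2 ≤ (t * f' t - f t) / t ^ 2 := by
    rw [div_le_div_iff₀ (by positivity) (by positivity)]
    exact linearization_mul_sq_le hf h0 hconv hs hst ht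
  have i4 := linearization_nonneg hf h0 hmono hsm
  have i5 := linearization_nonneg hf h0 hmono htm
  have i6 : ((f' s) ^ 2)⁻¹ ≤ ((f' t) ^ 2)⁻¹ :=
    inv_anti₀ (sq_pos_of_neg hft) (by nlinarith)
  -- Three nonnegative nondecreasing factors; the last one because `f'` increases while staying
  -- negative.
  have e : ∀ a, (f' a + 1 + κ) * (f' a * a - f a) / (a * f' a) ^ 2 =
      (f' a + 1 + κ) * ((a * f' a - f a) / a ^ 2) * ((f' a) ^ 2)⁻¹ := fun a ↦ by
    rw [mul_pow, mul_comm (f' a) a, div_eq_mul_inv, div_eq_mul_inv, mul_inv]; ring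
  rw [e, e]
  have j1 : 0 ≤ f' t + 1 + κ := by linarith
  have j2 : 0 ≤ (s * f' s - f s) / s ^ 2 := by positivity
  have j3 : 0 ≤ (t * f' t - f t) / t ^ 2 := by positivity
  exact mul_le_mul (mul_le_mul (by linarith) i3 j2 j1) i6 (by positivity) (mul_nonneg j1 j3)

/-- By `linearization_le` the quotient is at most `(f' t + 1 + κ) (f' t + 1) / (f' t) ^ 2`, which
tends to `0` as `t → 0⁺` because `f' 0 = -1`. -/
theorem exists_rate_lt_one (hR : 0 < R)
    (hf : ∀ t ∈ Set.Ico 0 R, HasDerivWithinAt f (f' t) (Set.Ico 0 R) t)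
    (hf' : ContinuousOn f' (Set.Ico 0 R)) (h0 : f 0 = 0) (h0' : f' 0 = -1)
    (hmono : MonotoneOn f' (Set.Ico 0 R)) {κ : ℝ} (hκ : 0 ≤ κ) {ν : ℝ} (hν : 0 < ν) :
    ∃ t ∈ Set.Ioo 0 ν, (f' t + 1 + κ) * (t * f' t - f t) / (t * (f' t) ^ 2) < 1 := by
  have h0m : (0 : ℝ) ∈ Set.Ico 0 R := ⟨le_rfl, hR⟩
  have hle : nhdsWithin (0 : ℝ) (Set.Ioi 0) ≤ nhdsWithin 0 (Set.Ico 0 R) := by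
    rw [← nhdsWithin_Ioo_eq_nhdsGT hR]
    exact nhdsWithin_mono _ Set.Ioo_subset_Ico_self
  have hc : ContinuousWithinAt (fun t ↦ (f' t + 1 + κ) * (f' t + 1) / (f' t) ^ 2)
      (Set.Ico 0 R) 0 := by
    have := hf' 0 h0m
    refine ContinuousWithinAt.div (by fun_prop) (by fun_prop) (by simp [h0'])
  have hlim := (hc.tendsto.mono_left hle).eventually_lt_const (u := 1) (by simp [h0'])
  have hneg := ((hf' 0 h0m).tendsto.mono_left hle).eventually_lt_const (u := 0) (by simp [h0'])
  obtain ⟨t, h1, h2, h3, h4⟩ := (hlim.and (hneg.and (Filter.Eventually.and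
    (Ioo_mem_nhdsGT hν) (Ioo_mem_nhdsGT hR)))).exists
  refine ⟨t, h3, lt_of_le_of_lt ?_ h1⟩
  have htm : t ∈ Set.Ico 0 R := ⟨h4.1.le, h4.2⟩
  have a := linearization_le hf h0 hmono htm
  have b := hmono h0m htm h4.1.le
  have h5 : 0 < (f' t) ^ 2 := sq_pos_of_neg h2
  rw [div_le_div_iff₀ (mul_pos h4.1 h5) h5]
  have : (f' t + 1 + κ) * (t * f' t - f t) ≤ (f' t + 1 + κ) * (t * (f' t + 1)) := by
    apply mul_le_mul_of_nonneg_left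
    · rw [h0'] at a; linarith
    · linarith
  nlinarith

end Majorant

end ProxGN

namespace ProxGN

/-! ### Linearization error of `F` -/

section MeanValue

variable {𝕜 : Type*} [RCLike 𝕜]
  {X : Type*} [NormedAddCommGroup X] [NormedSpace 𝕜 X]
  {Y : Type*} [NormedAddCommGroup Y] [NormedSpace 𝕜 Y]

/-- Majorization of the linearization error of `F` by the one of the scalar majorant. -/
theorem norm_linearization_le {F : X → Y} {A : X → X →L[𝕜] Y} {xs x : X}
    (hF : ∀ u ∈ Set.Icc (0 : ℝ) 1,
      HasFDerivAt F (A (xs + (u : 𝕜) • (x - xs))) (xs + (u : 𝕜) • (x - xs)))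
    (hF0 : F xs = 0) {f f' : ℝ → ℝ} {R β : ℝ} (hβ : 0 < β)
    (hf : ∀ t ∈ Set.Ico 0 R, HasDerivWithinAt f (f' t) (Set.Ico 0 R) t) (h0 : f 0 = 0)
    (hx : ‖x - xs‖ < R)
    (hmaj : ∀ u ∈ Set.Icc (0 : ℝ) 1, β * ‖A x - A (xs + (u : 𝕜) • (x - xs))‖
        ≤ f' ‖x - xs‖ - f' (u * ‖x - xs‖)) :
    β * ‖A x (x - xs) - F x‖ ≤ ‖x - xs‖ * f' ‖x - xs‖ - f ‖x - xs‖ := by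
  let _ : NormedSpace ℝ Y := NormedSpace.restrictScalars ℝ 𝕜 Y
  let _ : NormedSpace ℝ X := NormedSpace.restrictScalars ℝ 𝕜 X
  have _ : IsScalarTower ℝ 𝕜 X := .restrictScalars ℝ 𝕜 X
  have _ : IsScalarTower ℝ 𝕜 Y := .restrictScalars ℝ 𝕜 Y
  set v := x - xs with hv
  have hsm : ∀ u : ℝ, (u : 𝕜) • v = u • v := fun u ↦ (RCLike.real_smul_eq_coe_smul u v).symm
  simp only [hsm] at hF hmaj
  have hd : ∀ u ∈ Set.Icc (0 : ℝ) 1, HasDerivAt (fun u : ℝ ↦ u • A x v - F (xs + u • v))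
      ((A x - A (xs + u • v)) v) u := fun u hu ↦ by
    have h1 : HasDerivAt (fun u : ℝ ↦ xs + u • v) ((1 : ℝ) • v) u :=
      ((hasDerivAt_id u).smul_const v).const_add xs
    have h2 := ((hF u hu).restrictScalars ℝ).comp_hasDerivAt u h1
    have h3 := ((hasDerivAt_id u).smul_const (A x v)).sub h2
    refine h3.congr_deriv ?_
    simp
  have hs : ‖v‖ ∈ Set.Ico 0 R := ⟨norm_nonneg v, hx⟩
  have hB := fun u (hu : u ∈ Set.Icc (0 : ℝ) 1) ↦
    (hasDerivWithinAt_linearization hf hs hu).div_const β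
  -- Both curves start at `0`, and the speed of the vector curve is at most the derivative of the
  -- scalar one.
  have key := image_norm_le_of_norm_deriv_right_le_deriv_boundary'
    (fun u hu ↦ (hd u hu).continuousAt.continuousWithinAt)
    (fun u hu ↦ (hd u (Set.Ico_subset_Icc_self hu)).hasDerivWithinAt)
    (by simp [hF0, h0])
    (fun u hu ↦ (hB u hu).continuousWithinAt)
    (fun u hu ↦ (hB u (Set.Ico_subset_Icc_self hu)).mono_of_mem_nhdsWithin
      (Filter.mem_of_superset (Icc_mem_nhdsGE hu.2) (Set.Icc_subset_Icc_left hu.1)))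
    (fun u hu ↦ by
      have := hmaj u (Set.Ico_subset_Icc_self hu)
      rw [le_div_iff₀ hβ]
      have h2 := (A x - A (xs + u • v)).le_opNorm v
      nlinarith [norm_nonneg v])
    (Set.right_mem_Icc.2 zero_le_one)
  simp only [one_smul, one_mul] at key
  rw [le_div_iff₀ hβ, hv, add_sub_cancel] at key
  linarith

end MeanValue

/-! ### The proximity operator in the metric `A* A` -/

section Prox

variable {𝕜 : Type*} [RCLike 𝕜]
  {X : Type*} [NormedAddCommGroup X] [InnerProductSpace 𝕜 X]
  {Y : Type*} [NormedAddCommGroup Y] [InnerProductSpace 𝕜 Y]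

/-- The exact defect `t (1 - t) ‖w - v‖ ^ 2` is the strong convexity behind both the Cauchy property
of minimizing sequences and quadratic growth. -/
theorem norm_sq_convexComb (v w : Y) (t : ℝ) :
    ‖((1 - t : ℝ) : 𝕜) • v + (t : 𝕜) • w‖ ^ 2 =
      (1 - t) * ‖v‖ ^ 2 + t * ‖w‖ ^ 2 - t * (1 - t) * ‖w - v‖ ^ 2 := by
  rw [@norm_add_sq 𝕜, @norm_sub_sq 𝕜, inner_smul_left, inner_smul_right, norm_smul, norm_smul,
    RCLike.norm_ofReal, RCLike.norm_ofReal, mul_pow, mul_pow, sq_abs, sq_abs, RCLike.conj_ofReal,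
    RCLike.re_ofReal_mul, RCLike.re_ofReal_mul, ← inner_conj_symm v w, RCLike.conj_re]
  ring

theorem norm_sq_map_convexComb (A : X →L[𝕜] Y) (x y z : X) (t : ℝ) :
    ‖A (((1 - t : ℝ) : 𝕜) • x + (t : 𝕜) • y - z)‖ ^ 2 =
      (1 - t) * ‖A (x - z)‖ ^ 2 + t * ‖A (y - z)‖ ^ 2 - t * (1 - t) * ‖A (y - x)‖ ^ 2 := by
  have e : A (y - x) = A (y - z) - A (x - z) := by rw [← map_sub]; congr 1; abel
  rw [e, ← norm_sq_convexComb (𝕜 := 𝕜), ← map_smul, ← map_smul, ← map_add]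
  congr 3
  have : z = ((1 - t : ℝ) : 𝕜) • z + (t : 𝕜) • z := by
    rw [← add_smul, ← RCLike.ofReal_add]; simp
  conv_lhs => rw [this]
  simp only [smul_sub]; abel

theorem norm_map_convexComb_le (A : X →L[𝕜] Y) {x y z : X} {t a : ℝ} (ht : t ∈ Set.Icc (0 : ℝ) 1)
    (hx : ‖A (x - z)‖ ≤ a) (hy : ‖A (y - z)‖ ≤ a) :
    ‖A (((1 - t : ℝ) : 𝕜) • x + (t : 𝕜) • y - z)‖ ≤ a := by
  have ha : 0 ≤ a := (norm_nonneg _).trans hx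
  refine le_of_sq_le_sq ?_ ha
  rw [norm_sq_map_convexComb]
  have h1 := pow_le_pow_left₀ (norm_nonneg _) hx 2
  have h2 := pow_le_pow_left₀ (norm_nonneg _) hy 2
  have h3 : 0 ≤ t * (1 - t) * ‖A (y - x)‖ ^ 2 :=
    mul_nonneg (mul_nonneg ht.1 (sub_nonneg.2 ht.2)) (sq_nonneg _)
  nlinarith [mul_le_mul_of_nonneg_left h1 (sub_nonneg.2 ht.2), mul_le_mul_of_nonneg_left h2 ht.1]

theorem IsProperConvexLscOn.le_convexComb {Ω : Set X} {J : X → EReal}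
    (hJ : IsProperConvexLscOn 𝕜 Ω J) {x y : X} {v w t : ℝ} (ht : t ∈ Set.Ioo (0 : ℝ) 1)
    (hx : J x ≤ v) (hy : J y ≤ w) (hm : ((1 - t : ℝ) : 𝕜) • x + (t : 𝕜) • y ∈ Ω) :
    J (((1 - t : ℝ) : 𝕜) • x + (t : 𝕜) • y) ≤ (((1 - t) * v + t * w : ℝ) : EReal) := by
  refine (hJ.convex x y (1 - t) t (sub_pos.2 ht.2) ht.1 (by ring) hm).trans ?_
  rw [EReal.coe_add, EReal.coe_mul, EReal.coe_mul]
  exact add_le_add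
    (mul_le_mul_of_nonneg_left hx (EReal.coe_nonneg.2 (sub_nonneg.2 ht.2.le)))
    (mul_le_mul_of_nonneg_left hy (EReal.coe_nonneg.2 ht.1.le))

/-- Strong convexity turns minimality along the initial part of the segment from `p` to `y` into
quadratic growth. -/
theorem IsProperConvexLscOn.quadratic_growth {Ω : Set X} {J : X → EReal}
    (hJ : IsProperConvexLscOn 𝕜 Ω J) (A : X →L[𝕜] Y) {z p y : X} {j w m : ℝ}
    (hp : J p ≤ j) (hy : J y ≤ w)
    (hmin : ∀ᶠ t : ℝ in nhdsWithin 0 (Set.Ioi 0),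
      ((1 - t : ℝ) : 𝕜) • p + (t : 𝕜) • y ∈ Ω ∧
      ∀ v : ℝ, J (((1 - t : ℝ) : 𝕜) • p + (t : 𝕜) • y) ≤ v →
        m ≤ v + 1 / 2 * ‖A (((1 - t : ℝ) : 𝕜) • p + (t : 𝕜) • y - z)‖ ^ 2)
    (hm : j + 1 / 2 * ‖A (p - z)‖ ^ 2 ≤ m) :
    m + 1 / 2 * ‖A (y - p)‖ ^ 2 ≤ w + 1 / 2 * ‖A (y - z)‖ ^ 2 := by
  have hlim : Filter.Tendsto (fun t : ℝ ↦ m + 1 / 2 * (1 - t) * ‖A (y - p)‖ ^ 2)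
      (nhdsWithin 0 (Set.Ioi 0)) (nhds (m + 1 / 2 * ‖A (y - p)‖ ^ 2)) := by
    have : Continuous (fun t : ℝ ↦ m + 1 / 2 * (1 - t) * ‖A (y - p)‖ ^ 2) := by fun_prop
    simpa using (this.tendsto 0).mono_left nhdsWithin_le_nhds
  refine le_of_tendsto hlim ?_
  filter_upwards [hmin, Ioo_mem_nhdsGT (zero_lt_one' ℝ)] with t ⟨htΩ, hmt⟩ ht
  have h := hmt _ (hJ.le_convexComb ht hp hy htΩ)
  rw [norm_sq_map_convexComb] at h
  -- By `hm`, the share of `p` is at most `(1 - t) m`; what remains is divisible by `t`.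
  have h1 : t * (m + 1 / 2 * (1 - t) * ‖A (y - p)‖ ^ 2) ≤ t * (w + 1 / 2 * ‖A (y - z)‖ ^ 2) := by
    nlinarith [mul_le_mul_of_nonneg_left hm (sub_nonneg.2 ht.2.le)]
  exact le_of_mul_le_mul_left h1 ht.1

variable [CompleteSpace X]

/-- A proper convex lower semicontinuous functional plus a coercive quadratic form attains its
infimum on a sublevel ellipsoid contained in the domain. -/
theorem IsProperConvexLscOn.exists_min_on_ellipsoid {Ω : Set X} {J : X → EReal}
    (hJ : IsProperConvexLscOn 𝕜 Ω J) {A : X →L[𝕜] Y} {c : ℝ} (hc : 0 < c)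
    (hA : ∀ v, c * ‖v‖ ≤ ‖A v‖) {xs z : X} {j₀ a : ℝ} (ha : 0 ≤ a) (hj₀ : J xs = j₀)
    (hJmin : ∀ y, J xs ≤ J y) (hE : ∀ x, ‖A (x - xs)‖ ≤ a → x ∈ Ω) :
    ∃ p, ∃ j : ℝ, ‖A (p - xs)‖ ≤ a ∧ J p = j ∧ ∀ y, ‖A (y - xs)‖ ≤ a → ∀ v : ℝ, J y ≤ v →
      j + 1 / 2 * ‖A (p - z)‖ ^ 2 ≤ v + 1 / 2 * ‖A (y - z)‖ ^ 2 := by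
  -- Values are taken over the epigraph, which keeps them real.
  set S : Set ℝ := {s | ∃ y, ∃ v : ℝ, ‖A (y - xs)‖ ≤ a ∧ J y ≤ v ∧
    v + 1 / 2 * ‖A (y - z)‖ ^ 2 = s} with hS
  have hlow : ∀ y, ∀ v : ℝ, J y ≤ v → j₀ ≤ v := fun y v h ↦ by
    have := (hJmin y).trans h
    rw [hj₀] at this
    exact EReal.coe_le_coe_iff.1 this
  have hbdd : BddBelow S := ⟨j₀, by
    rintro s ⟨y, v, -, h, rfl⟩
    have := hlow y v h
    nlinarith [sq_nonneg ‖A (y - z)‖]⟩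
  have hne : S.Nonempty := ⟨_, xs, j₀, by simpa using ha, hj₀.le, rfl⟩
  set m := sInf S with hm
  have hmle : ∀ y, ‖A (y - xs)‖ ≤ a → ∀ v : ℝ, J y ≤ v → m ≤ v + 1 / 2 * ‖A (y - z)‖ ^ 2 :=
    fun y hy v hv ↦ csInf_le hbdd ⟨y, v, hy, hv, rfl⟩
  have hex : ∀ n : ℕ, ∃ y, ∃ v : ℝ, ‖A (y - xs)‖ ≤ a ∧ J y ≤ v ∧
      v + 1 / 2 * ‖A (y - z)‖ ^ 2 < m + 1 / ((n : ℝ) + 1) := fun n ↦ by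
    obtain ⟨s, ⟨y, v, h1, h2, rfl⟩, h3⟩ := exists_lt_of_csInf_lt hne
      (show sInf S < m + 1 / ((n : ℝ) + 1) from lt_add_of_pos_right _ (by positivity))
    exact ⟨y, v, h1, h2, h3⟩
  choose x v hxa hxv hxm using hex
  have hhalf : (1 / 2 : ℝ) ∈ Set.Ioo (0 : ℝ) 1 := by norm_num
  -- The midpoint has value at least `m`, while its convexity defect is `1 / 8` of the squared
  -- distance.
  have hdist : ∀ k n : ℕ, ‖A (x n - x k)‖ ^ 2 ≤ 4 * (1 / ((k : ℝ) + 1) + 1 / ((n : ℝ) + 1)) := by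
    intro k n
    have hmid := norm_map_convexComb_le A (Set.Ioo_subset_Icc_self hhalf) (hxa k) (hxa n)
    have h := hmle _ hmid _ (hJ.le_convexComb hhalf (hxv k) (hxv n) (hE _ hmid))
    rw [norm_sq_map_convexComb] at h
    linarith [hxm k, hxm n]
  have hcauchy : CauchySeq x := by
    rw [Metric.cauchySeq_iff']
    intro ε hε
    obtain ⟨N, hN⟩ := exists_nat_one_div_lt (show 0 < (c * ε) ^ 2 / 8 by positivity)
    refine ⟨N, fun n hn ↦ ?_⟩
    have h1 : 1 / ((n : ℝ) + 1) ≤ 1 / ((N : ℝ) + 1) := by gcongr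
    have h2 : ‖A (x n - x N)‖ ^ 2 < (c * ε) ^ 2 := by linarith [hdist N n]
    have h3 := (hA _).trans_lt (lt_of_pow_lt_pow_left₀ 2 (by positivity) h2)
    rw [dist_eq_norm]
    exact lt_of_mul_lt_mul_left h3 hc.le
  obtain ⟨p, hp⟩ := cauchySeq_tendsto_of_complete hcauchy
  have hAcont : ∀ y, Filter.Tendsto (fun n ↦ ‖A (x n - y)‖) Filter.atTop (nhds ‖A (p - y)‖) :=
    fun y ↦ (((by fun_prop : Continuous fun u ↦ ‖A (u - y)‖).tendsto p).comp hp)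
  have hpa : ‖A (p - xs)‖ ≤ a := le_of_tendsto' (hAcont xs) hxa
  have hlimv : Filter.Tendsto (fun n : ℕ ↦ m + 1 / ((n : ℝ) + 1) - 1 / 2 * ‖A (x n - z)‖ ^ 2)
      Filter.atTop (nhds (m + 0 - 1 / 2 * ‖A (p - z)‖ ^ 2)) :=
    (tendsto_const_nhds.add tendsto_one_div_add_atTop_nhds_zero_nat).sub
      (tendsto_const_nhds.mul ((hAcont z).pow 2))
  rw [add_zero] at hlimv
  -- Otherwise a real `w` strictly between would lie below `J (x n)` eventually, while `J (x n) ≤ v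
  -- n` is bounded by a sequence tending to less than `w`.
  have hJp : J p ≤ ((m - 1 / 2 * ‖A (p - z)‖ ^ 2 : ℝ) : EReal) := by
    by_contra! hlt
    obtain ⟨w, hLw, hwJ⟩ := EReal.lt_iff_exists_real_btwn.1 hlt
    have hxΩ : Filter.Tendsto x Filter.atTop (nhdsWithin p Ω) :=
      tendsto_nhdsWithin_iff.2 ⟨hp, .of_forall fun n ↦ hE _ (hxa n)⟩
    refine (EReal.coe_lt_coe_iff.1 hLw).not_ge (ge_of_tendsto hlimv ?_)
    filter_upwards [hxΩ.eventually (hJ.lsc p (hE p hpa) w hwJ)] with n hn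
    have := EReal.coe_lt_coe_iff.1 (lt_of_lt_of_le hn (hxv n))
    linarith [hxm n]
  have hreal : J p = ((J p).toReal : EReal) :=
    (EReal.coe_toReal (hJp.trans_lt (EReal.coe_lt_top _)).ne (hJ.ne_bot p)).symm
  refine ⟨p, (J p).toReal, hpa, hreal, fun y hy v hv ↦ ?_⟩
  rw [hreal, EReal.coe_le_coe_iff] at hJp
  linarith [hmle y hy v hv]

theorem proxObjective_eq [CompleteSpace Y] (J : X → EReal) (A : X →L[𝕜] Y) (z x : X) :
    proxObjective J (ContinuousLinearMap.adjoint A ∘L A) z x =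
      J x + ((1 / 2 * ‖A (x - z)‖ ^ 2 : ℝ) : EReal) := by
  rw [proxObjective, ContinuousLinearMap.comp_apply, ContinuousLinearMap.adjoint_inner_right,
    inner_self_eq_norm_sq]

/-- Existence and uniqueness of the proximal point near a minimizer of `J`, and nonexpansiveness
of the proximity operator there. -/
theorem IsProperConvexLscOn.existsUnique_isProxPoint [CompleteSpace Y] {Ω : Set X} {J : X → EReal}
    (hJ : IsProperConvexLscOn 𝕜 Ω J) {A : X →L[𝕜] Y} {c d : ℝ} (hc : 0 < c)
    (hA : ∀ v, c * ‖v‖ ≤ ‖A v‖) {xs z : X} (hball : Metric.ball xs d ⊆ Ω)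
    (hfin : J xs ≠ ⊤) (hJmin : ∀ y, J xs ≤ J y) (hz : ‖A (z - xs)‖ < c * d) :
    ∃ p, IsProxPoint J (ContinuousLinearMap.adjoint A ∘L A) z p ∧
      (∀ q, IsProxPoint J (ContinuousLinearMap.adjoint A ∘L A) z q → q = p) ∧
      ‖A (p - xs)‖ ≤ ‖A (z - xs)‖ := by
  have hj₀ : J xs = ((J xs).toReal : EReal) := (EReal.coe_toReal hfin (hJ.ne_bot xs)).symm
  set j₀ := (J xs).toReal
  -- The ellipsoid of radius `a` fits in the ball, yet has `z` strictly inside.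
  obtain ⟨a, hza, had⟩ := exists_between hz
  have ha : 0 ≤ a := (norm_nonneg _).trans hza.le
  have hE : ∀ x, ‖A (x - xs)‖ ≤ a → x ∈ Ω := fun x hx ↦ hball <| by
    rw [mem_ball_iff_norm]
    exact lt_of_mul_lt_mul_left ((hA _).trans_lt (hx.trans_lt had)) hc.le
  obtain ⟨p, j, hpa, hpj, hpmin⟩ := hJ.exists_min_on_ellipsoid hc hA (z := z) ha hj₀ hJmin hE
  have hj : j₀ ≤ j := by
    have := hJmin p
    rw [hj₀, hpj] at this
    exact EReal.coe_le_coe_iff.1 this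
  -- Quadratic growth at `y = xs`, together with `J xs ≤ J p`.
  have hpz : ‖A (p - xs)‖ ≤ ‖A (z - xs)‖ := by
    have h := hJ.quadratic_growth A (z := z) (y := xs) hpj.le hj₀.le ?_ le_rfl
    · refine le_of_sq_le_sq ?_ (norm_nonneg _)
      rw [← norm_neg (A (p - xs)), ← map_neg, neg_sub, ← norm_neg (A (z - xs)), ← map_neg, neg_sub]
      nlinarith [sq_nonneg ‖A (p - z)‖]
    · filter_upwards [Ioo_mem_nhdsGT (zero_lt_one' ℝ)] with t ht
      have := norm_map_convexComb_le A (Set.Ioo_subset_Icc_self ht) hpa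
        (show ‖A (xs - xs)‖ ≤ a by simpa using ha)
      exact ⟨hE _ this, fun v hv ↦ hpmin _ this v hv⟩
  -- By `hpz`, `p` is interior to the ellipsoid, so every segment from `p` starts inside it and
  -- local minimality becomes global.
  have hgrow : ∀ y, ∀ w : ℝ, J y ≤ w →
      j + 1 / 2 * ‖A (p - z)‖ ^ 2 + 1 / 2 * ‖A (y - p)‖ ^ 2 ≤ w + 1 / 2 * ‖A (y - z)‖ ^ 2 := by
    intro y w hw
    refine hJ.quadratic_growth A hpj.le hw ?_ le_rfl
    have hcont : Continuous fun t : ℝ ↦ ‖A (((1 - t : ℝ) : 𝕜) • p + (t : 𝕜) • y - xs)‖ := by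
      have : Continuous fun t : ℝ ↦ (t : 𝕜) := RCLike.continuous_ofReal
      have h2 : Continuous fun t : ℝ ↦ ((1 - t : ℝ) : 𝕜) := this.comp (by fun_prop)
      fun_prop
    have hlt := ((hcont.tendsto 0).mono_left
      (nhdsWithin_le_nhds (s := Set.Ioi 0))).eventually_lt_const (u := a)
      (by simpa using hpz.trans_lt hza)
    filter_upwards [hlt] with t ht
    exact ⟨hE _ ht.le, fun v hv ↦ hpmin _ ht.le v hv⟩
  refine ⟨p, fun y ↦ ?_, fun q hq ↦ ?_, hpz⟩
  · rw [proxObjective_eq, proxObjective_eq]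
    by_cases hy : J y = ⊤
    · rw [hy, EReal.top_add_coe]; exact le_top
    · have hyr := EReal.coe_toReal hy (hJ.ne_bot y)
      rw [← hyr, hpj, ← EReal.coe_add, ← EReal.coe_add, EReal.coe_le_coe_iff]
      have := hgrow y _ hyr.ge
      nlinarith [sq_nonneg ‖A (y - p)‖]
  · have h := hq p
    rw [proxObjective_eq, proxObjective_eq, hpj, ← EReal.coe_add] at h
    have hqt : J q ≠ ⊤ := fun ht ↦ by
      rw [ht, EReal.top_add_coe] at h
      exact absurd h (not_le.2 (EReal.coe_lt_top _))
    have hqr := EReal.coe_toReal hqt (hJ.ne_bot q)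
    rw [← hqr, ← EReal.coe_add, EReal.coe_le_coe_iff] at h
    have h1 := hgrow q _ hqr.ge
    have h2 : ‖A (q - p)‖ ^ 2 ≤ 0 := by linarith
    have h3 : ‖A (q - p)‖ = 0 := by
      exact pow_eq_zero_iff (two_ne_zero) |>.1 (le_antisymm h2 (sq_nonneg _))
    have h4 := hA (q - p)
    rw [h3] at h4
    exact sub_eq_zero.1 (norm_le_zero_iff.1 (by nlinarith [norm_nonneg (q - p)]))

end Prox

end ProxGN
-- Local quadratic convergence
theorem corollary3p2 {𝕜 : Type*} [RCLike 𝕜]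
    {X : Type*} [NormedAddCommGroup X] [InnerProductSpace 𝕜 X] [CompleteSpace X]
    {Y : Type*} [NormedAddCommGroup Y] [InnerProductSpace 𝕜 Y] [CompleteSpace Y]
    (Ω : Set X) (hΩ : IsOpen Ω)
    (J : X → EReal) (hJ : ProxGN.IsProperConvexLscOn 𝕜 Ω J)
    (F : X → Y) (hF : ContDiffOn 𝕜 1 F Ω)
    (hFclosed : ∀ x ∈ Ω, IsClosed (Set.range (fderiv 𝕜 F x)))
    (xs : X) (hxs : xs ∈ Ω) (R : ℝ) (hR : 0 < R)
    (β κ δ : ℝ)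
    (hβ : β = ‖ProxGN.pinv (fderiv 𝕜 F xs)‖)
    (hκ : κ = β * ‖fderiv 𝕜 F xs‖)
    (hδ : δ = sSup {t : ℝ | t ∈ Set.Ico 0 R ∧ Metric.ball xs t ⊆ Ω})
    (hF0 : F xs = 0)
    (hJ0 : (0 : X) ∈ ProxGN.subdifferential 𝕜 J xs)
    (hinj : Function.Injective (fderiv 𝕜 F xs))
    -- the majorant function `f` and its derivative `f'` on `[0, R)` (one-sided at `0`)
    (f f' : ℝ → ℝ)
    (hf : ∀ t ∈ Set.Ico 0 R, HasDerivWithinAt f (f' t) (Set.Ico 0 R) t)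
    (hf' : ContinuousOn f' (Set.Ico 0 R))
    (hmaj : ∀ x ∈ Metric.ball xs δ, ∀ τ ∈ Set.Icc (0 : ℝ) 1,
      β * ‖fderiv 𝕜 F x - fderiv 𝕜 F (xs + (τ : 𝕜) • (x - xs))‖
        ≤ f' ‖x - xs‖ - f' (τ * ‖x - xs‖))
    (h1 : f 0 = 0 ∧ f' 0 = -1)
    (h2 : ConvexOn ℝ (Set.Ico 0 R) f' ∧ StrictMonoOn f' (Set.Ico 0 R))
    (ν ρ r : ℝ)
    (hν : ν = sSup {t : ℝ | t ∈ Set.Ico 0 R ∧ f' t < 0})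
    (hρ : ρ = sSup {t : ℝ | t ∈ Set.Ioo 0 ν ∧
      (f' t + 1 + κ) * (t * f' t - f t) / (t * (f' t) ^ 2) < 1})
    (hr : r = min ρ δ) :
    (0 < δ ∧ 0 < ν ∧ 0 < ρ ∧ 0 < r) ∧
    ∀ x₀ ∈ Metric.ball xs r \ {xs},
      (∀ k, ProxGN.StepWellDefined 𝕜 Ω F J (ProxGN.iterate 𝕜 F J x₀ k)) ∧
      (∀ k, ProxGN.iterate 𝕜 F J x₀ k ∈ Metric.ball xs r) ∧
      Filter.Tendsto (ProxGN.iterate 𝕜 F J x₀) Filter.atTop (nhds xs) ∧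
      ∀ k, ‖ProxGN.iterate 𝕜 F J x₀ (k + 1) - xs‖ ≤
        (f' ‖x₀ - xs‖ + 1 + κ) * (f' ‖x₀ - xs‖ * ‖x₀ - xs‖ - f ‖x₀ - xs‖)
          / (‖x₀ - xs‖ * f' ‖x₀ - xs‖) ^ 2 * ‖ProxGN.iterate 𝕜 F J x₀ k - xs‖ ^ 2 := by
  obtain ⟨h10, h11⟩ := h1
  obtain ⟨hconv, hstrict⟩ := h2
  have hmono := hstrict.monotoneOn
  have h0m : (0 : ℝ) ∈ Set.Ico 0 R := ⟨le_rfl, hR⟩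
  -- the radii
  have hbδ : BddAbove {t : ℝ | t ∈ Set.Ico 0 R ∧ Metric.ball xs t ⊆ Ω} :=
    ⟨R, fun t ht ↦ ht.1.2.le⟩
  have hbν : BddAbove {t : ℝ | t ∈ Set.Ico 0 R ∧ f' t < 0} := ⟨R, fun t ht ↦ ht.1.2.le⟩
  have hbρ : BddAbove {t : ℝ | t ∈ Set.Ioo 0 ν ∧
      (f' t + 1 + κ) * (t * f' t - f t) / (t * (f' t) ^ 2) < 1} := ⟨ν, fun t ht ↦ ht.1.2.le⟩
  have hκ0 : 0 ≤ κ := by rw [hκ, hβ]; positivity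
  have hδpos : 0 < δ := by
    obtain ⟨ε, hε, hεΩ⟩ := Metric.isOpen_iff.1 hΩ xs hxs
    have hmin : 0 < min ε (R / 2) := lt_min hε (by positivity)
    refine hmin.trans_le ?_
    rw [hδ]
    refine le_csSup hbδ ⟨⟨hmin.le, (min_le_right _ _).trans_lt (by linarith)⟩, ?_⟩
    exact (Metric.ball_subset_ball (min_le_left _ _)).trans hεΩ
  have hνpos : 0 < ν := by
    have hle : nhdsWithin (0 : ℝ) (Set.Ioi 0) ≤ nhdsWithin 0 (Set.Ico 0 R) := by
      rw [← nhdsWithin_Ioo_eq_nhdsGT hR]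
      exact nhdsWithin_mono _ Set.Ioo_subset_Ico_self
    have hneg := ((hf' 0 h0m).tendsto.mono_left hle).eventually_lt_const (u := 0) (by simp [h11])
    obtain ⟨t, h1, h2⟩ := (hneg.and (Ioo_mem_nhdsGT hR)).exists
    rw [hν]
    exact h2.1.trans_le (le_csSup hbν ⟨⟨h2.1.le, h2.2⟩, h1⟩)
  have hρne := ProxGN.exists_rate_lt_one hR hf hf' h10 h11 hmono hκ0 hνpos
  have hρpos : 0 < ρ := by
    obtain ⟨t, h1, h2⟩ := hρne
    rw [hρ]
    exact h1.1.trans_le (le_csSup hbρ ⟨h1, h2⟩)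
  have hrpos : 0 < r := hr ▸ lt_min hρpos hδpos
  refine ⟨⟨hδpos, hνpos, hρpos, hrpos⟩, ?_⟩
  rintro x₀ ⟨hx₀r, hx₀ne⟩
  rw [Set.mem_singleton_iff] at hx₀ne
  rw [mem_ball_iff_norm] at hx₀r
  have hδR : δ ≤ R := hδ ▸ csSup_le ⟨0, h0m, by simp⟩ fun t ht ↦ ht.1.2.le
  have hballΩ : Metric.ball xs δ ⊆ Ω := fun x hx ↦ by
    rw [Metric.mem_ball, hδ] at hx
    obtain ⟨t, ht, hlt⟩ := exists_lt_of_lt_csSup (by exact ⟨0, h0m, by simp⟩) hx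
    exact ht.2 hlt
  have hneg : ∀ s, 0 ≤ s → s < ν → s < R ∧ f' s < 0 := fun s hs hsν ↦ by
    rw [hν] at hsν
    obtain ⟨t, ht, hlt⟩ := exists_lt_of_lt_csSup (by exact ⟨0, h0m, by simp [h11]⟩) hsν
    have hsR := hlt.trans ht.1.2
    exact ⟨hsR, (hmono ⟨hs, hsR⟩ ht.1 hlt.le).trans_lt ht.2⟩
  have hρν : ρ ≤ ν := hρ ▸ csSup_le hρne fun t ht ↦ ht.1.2.le
  have hrρ : r ≤ ρ := hr ▸ min_le_left _ _
  have hrδ : r ≤ δ := hr ▸ min_le_right _ _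
  set C : ℝ → ℝ := fun s ↦ (f' s + 1 + κ) * (f' s * s - f s) / (s * f' s) ^ 2 with hC
  have hC0 : ∀ s, 0 ≤ s → s < r → 0 ≤ C s := fun s hs hsr ↦ by
    have hm : s ∈ Set.Ico 0 R := ⟨hs, hsr.trans_le (hrδ.trans hδR)⟩
    have := hmono h0m hm hs
    have := ProxGN.linearization_nonneg hf h10 hmono hm
    exact div_nonneg (mul_nonneg (by linarith) (by linarith)) (sq_nonneg _)
  have hCmono : ∀ s t, 0 < s → s ≤ t → t < r → C s ≤ C t := fun s t hs hst htr ↦ by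
    obtain ⟨h1, h2⟩ := hneg t (hs.le.trans hst) (htr.trans_le (hrρ.trans hρν))
    exact ProxGN.rate_mono hf h10 h11 hconv hmono hκ0 hs hst h1 h2
  -- The set defining `ρ` is not known to be an interval; monotonicity of `C` carries the bound down
  -- from a member `t > s`.
  have hClt : ∀ s, 0 < s → s < r → C s * s < 1 := fun s hs hsr ↦ by
    have hsρ := hsr.trans_le hrρ
    rw [hρ] at hsρ
    obtain ⟨t, ⟨ht, hq⟩, hlt⟩ := exists_lt_of_lt_csSup hρne hsρ
    obtain ⟨h1, h2⟩ := hneg t ht.1.le ht.2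
    have h3 := ProxGN.rate_mono hf h10 h11 hconv hmono hκ0 hs hlt.le h1 h2
    have e : C t * t = (f' t + 1 + κ) * (t * f' t - f t) / (t * (f' t) ^ 2) := by
      have := ht.1.ne'
      have := h2.ne
      simp only [hC]
      field_simp
    have hm : t ∈ Set.Ico 0 R := ⟨ht.1.le, h1⟩
    have h4 := hmono h0m hm ht.1.le
    have h5 := ProxGN.linearization_nonneg hf h10 hmono hm
    have h6 : 0 ≤ C t := div_nonneg (mul_nonneg (by linarith) (by linarith)) (sq_nonneg _)
    rw [← e] at hq
    calc C s * s ≤ C t * t := mul_le_mul h3 hlt.le hs.le h6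
      _ < 1 := hq
  -- the derivative at the solution
  obtain ⟨c₀, hc₀, hA₀⟩ := ProxGN.exists_pos_mul_norm_le hinj (hFclosed xs hxs)
  have hMP₀ := ProxGN.isMoorePenrose_pinv hc₀ hA₀
  have hβle : ∀ v, ‖v‖ ≤ β * ‖fderiv 𝕜 F xs v‖ := fun v ↦ by
    have := (ProxGN.pinv (fderiv 𝕜 F xs)).le_opNorm (fderiv 𝕜 F xs v)
    rwa [hMP₀.apply_apply hinj, ← hβ] at this
  have hv₀ : 0 < ‖x₀ - xs‖ := norm_pos_iff.2 (sub_ne_zero.2 hx₀ne)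
  -- `x₀ ≠ xs` makes `X` nontrivial.
  have hβpos : 0 < β := by
    have h1 : 0 ≤ β := hβ ▸ norm_nonneg _
    refine h1.lt_of_ne fun h ↦ ?_
    have := hβle (x₀ - xs)
    rw [← h, zero_mul] at this
    exact this.not_gt hv₀
  have hκ1 : 1 ≤ κ := by
    have h1 := hβle (x₀ - xs)
    have h2 := mul_le_mul_of_nonneg_left ((fderiv 𝕜 F xs).le_opNorm (x₀ - xs)) hβpos.le
    rw [hκ]
    by_contra! hlt
    nlinarith
  have hJmin : ∀ y, J xs ≤ J y := fun y ↦ by simpa using hJ0.2 y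
  have hder : ∀ x ∈ Metric.ball xs δ, HasFDerivAt F (fderiv 𝕜 F x) x := fun x hx ↦
    ((hF.contDiffAt (hΩ.mem_nhds (hballΩ hx))).differentiableAt one_ne_zero).hasFDerivAt
  have hstep : ∀ x, ‖x - xs‖ < r → ProxGN.StepWellDefined 𝕜 Ω F J x ∧
      ‖ProxGN.prox J (ProxGN.metricOp 𝕜 F x) (ProxGN.gaussNewtonPoint 𝕜 F x) - xs‖ ≤
        C ‖x - xs‖ * ‖x - xs‖ ^ 2 := by
    intro x hx
    set s := ‖x - xs‖ with hs
    have hs0 : 0 ≤ s := norm_nonneg _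
    have hxδ : x ∈ Metric.ball xs δ := mem_ball_iff_norm.2 (hx.trans_le hrδ)
    obtain ⟨hsR, hsneg⟩ := hneg s hs0 (hx.trans_le (hrρ.trans hρν))
    have hsm : s ∈ Set.Ico 0 R := ⟨hs0, hsR⟩
    set A := fderiv 𝕜 F x with hAdef
    have hA : ∀ v, -f' s / β * ‖v‖ ≤ ‖A v‖ := fun v ↦ by
      have h1 := hmaj x hxδ 0 ⟨le_rfl, zero_le_one⟩
      simp only [RCLike.ofReal_zero, zero_smul, add_zero, zero_mul, h11] at h1
      have h2 := (A - fderiv 𝕜 F xs).le_opNorm v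
      have h3 : ‖fderiv 𝕜 F xs v‖ ≤ ‖A v‖ + ‖(A - fderiv 𝕜 F xs) v‖ := by
        have : fderiv 𝕜 F xs v = A v - (A - fderiv 𝕜 F xs) v := by simp
        rw [this]
        exact norm_sub_le _ _
      have h4 := hβle v
      rw [div_mul_eq_mul_div, div_le_iff₀ hβpos]
      nlinarith [norm_nonneg v, mul_le_mul_of_nonneg_left h2 hβpos.le,
        mul_le_mul_of_nonneg_left h3 hβpos.le, mul_le_mul_of_nonneg_right h1 (norm_nonneg v)]
    have hc : 0 < -f' s / β := div_pos (by linarith) hβpos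
    have hAinj : Function.Injective A := (injective_iff_map_eq_zero A).2 fun v hv ↦ by
      have := hA v
      rw [hv, norm_zero] at this
      exact norm_le_zero_iff.1 (nonpos_of_mul_nonpos_right this hc)
    have hMP := ProxGN.isMoorePenrose_pinv hc hA
    set e := s * f' s - f s with he
    have he0 : 0 ≤ e := ProxGN.linearization_nonneg hf h10 hmono hsm
    have herr : β * ‖A (ProxGN.gaussNewtonPoint 𝕜 F x - xs)‖ ≤ e := by
      have h1 : β * ‖A (x - xs) - F x‖ ≤ e := by
        refine ProxGN.norm_linearization_le (A := fderiv 𝕜 F) (fun u hu ↦ hder _ ?_) hF0 hβpos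
          hf h10 hsR (hmaj x hxδ)
        rw [mem_ball_iff_norm, add_sub_cancel_left, norm_smul, RCLike.norm_ofReal,
          abs_of_nonneg hu.1]
        exact (mul_le_of_le_one_left hs0 hu.2).trans_lt (hx.trans_le hrδ)
      have h2 : ProxGN.gaussNewtonPoint 𝕜 F x - xs = ProxGN.pinv A (A (x - xs) - F x) := by
        rw [map_sub, hMP.apply_apply hAinj, ProxGN.gaussNewtonPoint]
        abel
      rw [h2]
      exact (mul_le_mul_of_nonneg_left (hMP.norm_apply_le _) hβpos.le).trans h1
    -- Uses `0 < -f' s ≤ 1 ≤ κ ≤ f' s + 1 + κ`.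
    have hbound : e / -f' s ≤ C s * s ^ 2 := by
      rcases hs0.eq_or_lt with h | h
      · simp [he, ← h, h10]
      have e1 : C s * s ^ 2 = (f' s + 1 + κ) * e / (f' s) ^ 2 := by
        have := h.ne'
        have := hsneg.ne
        simp only [hC, he]
        field_simp
      rw [e1, div_le_div_iff₀ (by linarith) (sq_pos_of_neg hsneg)]
      have h2 := hmono h0m hsm hs0
      have h3 : e * -f' s * -f' s ≤ e * -f' s * (f' s + 1 + κ) :=
        mul_le_mul_of_nonneg_left (by linarith) (mul_nonneg he0 (by linarith))
      nlinarith
    have hCs : C s * s ^ 2 ≤ s := by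
      rcases hs0.eq_or_lt with h | h
      · simp [← h]
      · nlinarith [hClt s h hx]
    have hlt : ‖A (ProxGN.gaussNewtonPoint 𝕜 F x - xs)‖ < -f' s / β * δ := by
      rw [div_mul_eq_mul_div, lt_div_iff₀ hβpos]
      have h1 : e / -f' s < δ := (hbound.trans hCs).trans_lt (hx.trans_le hrδ)
      rw [div_lt_iff₀ (by linarith)] at h1
      linarith
    obtain ⟨p, hp, huniq, hpz⟩ := hJ.existsUnique_isProxPoint hc hA hballΩ hJ0.1 hJmin hlt
    refine ⟨⟨hballΩ hxδ, hAinj, ProxGN.existsUnique_isMoorePenrose hc hA,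
      ProxGN.isUnit_adjoint_comp_self hc hA, p, hp, huniq⟩, ?_⟩
    have hprox : ProxGN.prox J (ProxGN.metricOp 𝕜 F x) (ProxGN.gaussNewtonPoint 𝕜 F x) = p :=
      huniq _ (Classical.epsilon_spec (p := ProxGN.IsProxPoint J _ _) ⟨p, hp⟩)
    rw [hprox]
    refine le_trans ?_ hbound
    rw [le_div_iff₀ (by linarith)]
    have h1 := (hA (p - xs)).trans hpz
    rw [div_mul_eq_mul_div, div_le_iff₀ hβpos] at h1
    linarith
  -- the iteration
  set s₀ := ‖x₀ - xs‖ with hs₀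
  have hC₀ : 0 ≤ C s₀ := hC0 s₀ hv₀.le hx₀r
  have hq0 : 0 ≤ C s₀ * s₀ := mul_nonneg hC₀ hv₀.le
  have hq1 := hClt s₀ hv₀ hx₀r
  have hrec : ∀ x, ‖x - xs‖ ≤ s₀ →
      ‖ProxGN.prox J (ProxGN.metricOp 𝕜 F x) (ProxGN.gaussNewtonPoint 𝕜 F x) - xs‖ ≤
        C s₀ * ‖x - xs‖ ^ 2 := fun x hx ↦ by
    refine (hstep x (hx.trans_lt hx₀r)).2.trans ?_
    -- `C` is monotone only at positive arguments.
    rcases (norm_nonneg (x - xs)).eq_or_lt with h | h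
    · simp [← h]
    · exact mul_le_mul_of_nonneg_right (hCmono _ _ h hx hx₀r) (sq_nonneg _)
  have hgeom : ∀ k, ‖ProxGN.iterate 𝕜 F J x₀ k - xs‖ ≤ (C s₀ * s₀) ^ k * s₀ := by
    intro k
    induction k with
    | zero => simp [ProxGN.iterate, hs₀]
    | succ k ih =>
      have hk : ‖ProxGN.iterate 𝕜 F J x₀ k - xs‖ ≤ s₀ :=
        ih.trans (mul_le_of_le_one_left hv₀.le (pow_le_one₀ hq0 hq1.le))
      calc ‖ProxGN.iterate 𝕜 F J x₀ (k + 1) - xs‖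
          ≤ C s₀ * ‖ProxGN.iterate 𝕜 F J x₀ k - xs‖ ^ 2 := hrec _ hk
        _ ≤ C s₀ * (s₀ * ‖ProxGN.iterate 𝕜 F J x₀ k - xs‖) := by
          rw [sq]; gcongr
        _ ≤ C s₀ * (s₀ * ((C s₀ * s₀) ^ k * s₀)) := by gcongr
        _ = (C s₀ * s₀) ^ (k + 1) * s₀ := by ring
  have hle : ∀ k, ‖ProxGN.iterate 𝕜 F J x₀ k - xs‖ ≤ s₀ := fun k ↦
    (hgeom k).trans (mul_le_of_le_one_left hv₀.le (pow_le_one₀ hq0 hq1.le))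
  refine ⟨fun k ↦ (hstep _ ((hle k).trans_lt hx₀r)).1,
    fun k ↦ mem_ball_iff_norm.2 ((hle k).trans_lt hx₀r), ?_, fun k ↦ hrec _ (hle k)⟩
  rw [tendsto_iff_norm_sub_tendsto_zero]
  refine squeeze_zero (fun k ↦ norm_nonneg _) hgeom ?_
  simpa using (tendsto_pow_atTop_nhds_zero_of_lt_one hq0 hq1).mul_const s₀
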